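/- A *generalised difference ring* $(R,\Sigma)$ is a commutative ring $R$ with a set $\Sigma$ of injective ring endomorphisms such that for all $\sigma,\tau\in\Sigma$ there is $\sigma^\tau\in\Sigma$ with $\tau\circ\sigma^\tau=\sigma\circ\tau$. Put $\mathrm{Spec}^\tau(R)=\{\mathfrak p\in\mathrm{Spec}(R):\tau^{-1}(\mathfrak p)=\mathfrak p\}$ and $\mathrm{Spec}^\Sigma(R)=\bigcup_{\tau\in\Sigma}\mathrm{Spec}^\tau(R)$, with the topology and structure sheaf induced from $\mathrm{Spec}(R)$; so the local ring at $\mathfrak p$ is $R_{\mathfrak p}$. Let $(k,\sigma)$ be a difference field, i.e. a field with an endomorphism. An (affine) *difference curve* over $(k,\sigma)$ is $X=\mathrm{Spec}^\Sigma(R)$, where $(R,\Sigma)$ is a generalised difference ring with $\Sigma$ finite and non-empty, $R$ is a $k$-algebra and an integral domain, and for each $\tau\in\Sigma$: * $\tau$ restricts to $\sigma$ on $k$; * $(R,\tau)$ is of finite $\tau$-type over $k$, i.e. there are $a_1,\dots,a_n\in R$ such that the elements $\tau^j(a_i)$ ($j\ge 0$, $1\le i\le n$) generate $R$ as a $k$-algebra;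 * $(R,\tau)$ has total dimension $1$, i.e. $\sup_{\mathfrak p}\mathrm{tr.deg}(\kappa(\mathfrak p)/k)=1$, where $\mathfrak p$ runs over the primes of $R$ with $\tau(\mathfrak p)\subseteq\mathfrak p$ and $\kappa(\mathfrak p)$ is the residue field. **Proposition (Generic non-singularity).** Let $X$ be a difference curve over a difference field of characteristic $0$. Then there is a non-empty open subset $U$ of $X$ such that every point $x\in U$ other than the generic point (the zero ideal) is non-singular, meaning that the local ring $\mathcal O_{X,x}$ is a discrete valuation ring. -/

import Mathlib

/-!
Generalised difference rings, their difference spectra, and affine difference curves.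
-/

/-- `(R, S)` is a generalised difference ring: `S` is a set of injective ring endomorphisms of `R`
such that for all `σ, τ ∈ S` there is `σ ^ τ ∈ S` with `τ ∘ σ ^ τ = σ ∘ τ`. Since `τ` is injective,
`σ ^ τ` is unique, `σ ^ σ = σ`, and the law `(σ ^ τ) ^ φ = (σ ^ φ) ^ (τ ^ φ)` holds
automatically (see `IsDifferenceRing.conj_self` and `IsDifferenceRing.conj_conj`). -/
structure IsDifferenceRing {R : Type*} [CommRing R] (S : Set (R →+* R)) : Prop where
  injective : ∀ τ ∈ S, Function.Injective τ
  exists_conj : ∀ σ ∈ S, ∀ τ ∈ S, ∃ ρ ∈ S, τ.comp ρ = σ.comp τ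

theorem IsDifferenceRing.conj_self {R : Type*} [CommRing R] {S : Set (R →+* R)}
    (h : IsDifferenceRing S) {σ ρ : R →+* R} (hσ : σ ∈ S) (hρ : σ.comp ρ = σ.comp σ) :
    ρ = σ :=
  RingHom.ext fun x => h.injective σ hσ (RingHom.congr_fun hρ x)

theorem IsDifferenceRing.conj_conj {R : Type*} [CommRing R] {S : Set (R →+* R)}
    (h : IsDifferenceRing S) {σ τ φ στ σφ τφ l r : R →+* R}
    (hτ : τ ∈ S) (hφ : φ ∈ S)
    (h₁ : τ.comp στ = σ.comp τ) (h₂ : φ.comp σφ = σ.comp φ) (h₃ : φ.comp τφ = τ.comp φ)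
    (hl : φ.comp l = στ.comp φ) (hr : τφ.comp r = σφ.comp τφ) : l = r := by
  ext x
  apply h.injective φ hφ
  apply h.injective τ hτ
  have e₁ := RingHom.congr_fun h₁ (φ x)
  have e₂ := RingHom.congr_fun h₂ (τφ x)
  have e₃ := RingHom.congr_fun h₃ (r x)
  have e₄ := RingHom.congr_fun h₃ x
  have e₅ := RingHom.congr_fun hl x
  have e₆ := RingHom.congr_fun hr x
  simp only [RingHom.comp_apply] at e₁ e₂ e₃ e₄ e₅ e₆
  rw [e₅, e₁, ← e₃, e₆, e₂, e₄]

/-- `Spec^τ(R)`: the primes `p` of `R` with `τ⁻¹(p) = p`. -/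
def fixedSpec {R : Type*} [CommRing R] (τ : R →+* R) : Set (PrimeSpectrum R) :=
  {p | PrimeSpectrum.comap τ p = p}

/-- `Spec^S(R) = ⋃_{τ ∈ S} Spec^τ(R)`, as a subset of `Spec R`. Coerced to a type it carries the
topology induced from the Zariski topology. -/
def differenceSpec {R : Type*} [CommRing R] (S : Set (R →+* R)) : Set (PrimeSpectrum R) :=
  ⋃ τ ∈ S, fixedSpec τ

/-- The local ring `𝒪_x` of `Spec^S(R)` at `x`. The structure sheaf is the restriction of the
structure sheaf of `Spec R`, so this is the localisation of `R` at the prime `x`. -/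
abbrev DifferenceLocalRing {R : Type*} [CommRing R] {S : Set (R →+* R)}
    (x : differenceSpec S) : Type _ :=
  Localization.AtPrime x.1.asIdeal

/-- The point `x` is non-singular: its local ring is a discrete valuation ring. -/
def IsNonsingularPoint {R : Type*} [CommRing R] {S : Set (R →+* R)}
    (x : differenceSpec S) : Prop :=
  ∃ _ : IsDomain (DifferenceLocalRing x), IsDiscreteValuationRing (DifferenceLocalRing x)

/-- `(R, τ)` is of finite `τ`-type over `k`: there are finitely many elements of `R` whose
iterated images under `τ` generate `R` as a `k`-algebra. -/
def IsFiniteDifferenceType (k : Type*) {R : Type*} [CommRing k] [CommRing R] [Algebra k R]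
    (τ : R →+* R) : Prop :=
  ∃ s : Finset R, Algebra.adjoin k {x : R | ∃ n : ℕ, ∃ a ∈ s, x = τ^[n] a} = ⊤

/-- The total dimension of `(R, τ)` over the field `k`: the supremum of the transcendence degrees
over `k` of the residue fields `κ(p)`, where `p` runs over the primes of `R` with `τ(p) ⊆ p`.
This is the degree in `𝕃` of the formal sum over these `p` of the terms
`(limit degree of κ(p)/k) * 𝕃 ^ (tr.deg(κ(p)/k))`, because limit degrees are at least `1`. -/
noncomputable def totalDimension (k : Type*) {R : Type*} [Field k] [CommRing R] [Algebra k R]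
    (τ : R →+* R) : ℕ∞ :=
  ⨆ p : {p : PrimeSpectrum R // ∀ a ∈ p.asIdeal, τ a ∈ p.asIdeal},
    Cardinal.toENat (Algebra.trdeg k p.1.asIdeal.ResidueField)

/-- `Spec^S(R)` is an affine difference curve over the difference field `(k, σ)`: `(R, S)` is a
generalised difference ring over `(k, σ)`, `R` is an integral domain, and for each `τ ∈ S`
the `(k, σ)`-algebra `(R, τ)` is of finite `τ`-type and of total dimension `1`. -/
structure IsAffineDifferenceCurve {k R : Type*} [Field k] [CommRing R] [Algebra k R]
    (σ : k →+* k) (S : Set (R →+* R)) : Prop where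
  isDifferenceRing : IsDifferenceRing S
  map_algebraMap : ∀ τ ∈ S, ∀ c : k, τ (algebraMap k R c) = algebraMap k R (σ c)
  isDomain : IsDomain R
  finiteType : ∀ τ ∈ S, IsFiniteDifferenceType k τ
  totalDimension_eq_one : ∀ τ ∈ S, totalDimension k τ = 1

open Polynomial

/-! If `R` is not algebraic over `k`, it is algebraic over some `k[t]`. Étale-style reasoning then
applies: adjoining to an algebra a root that stays simple modulo `p` preserves the property that a
generator `ϖ` of `p ∩ k[t]` generates the maximal ideal locally (`LocallyGenerates.of_simple_root`).
In characteristic 0, each of the finitely many elements `a` and `τ a`, with `a` a generator or `t`,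
is a simple root over `k[t]` away from a proper closed set. If `τ⁻¹(p) = p`, applying `τ^n`
transports this simplicity to all iterates (`isDiscreteValuationRing_of_comap_eq`), so finitely many
conditions control the infinitely many algebra generators. -/

/-- Every polynomial over the residue field of `q` becomes liftable to `A[X]` after multiplication by
an element outside `q`. -/
theorem Ideal.ResidueField.exists_map_eq_C_mul {A : Type*} [CommRing A] (q : Ideal A) [q.IsPrime]
    (g : q.ResidueField[X]) :
    ∃ c ∉ q, ∃ G : A[X], G.map (algebraMap A q.ResidueField) =
      C (algebraMap A q.ResidueField c) * g := by
  obtain ⟨b, hb, h⟩ := IsLocalization.integerNormalization_spec (nonZeroDivisors (A ⧸ q)) g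
  obtain ⟨c, rfl⟩ := Ideal.Quotient.mk_surjective b
  obtain ⟨G, hG⟩ := Polynomial.map_surjective (Ideal.Quotient.mk q) Ideal.Quotient.mk_surjective
    (IsLocalization.integerNormalization (nonZeroDivisors (A ⧸ q)) g)
  have e : (algebraMap (A ⧸ q) q.ResidueField).comp (Ideal.Quotient.mk q) =
      algebraMap A q.ResidueField := rfl
  refine ⟨c, fun hc => nonZeroDivisors.ne_zero hb (Ideal.Quotient.eq_zero_iff_mem.2 hc), G, ?_⟩
  rw [← hG, Polynomial.map_map, e] at h
  rw [h, ← Polynomial.smul_eq_C_mul, ← e]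
  exact algebra_compatible_smul q.ResidueField _ _

/-! ### Local generators and simple roots -/

/-- `ϖ` generates the maximal ideal of the localisation of `A` at the contraction of `p`. -/
def LocallyGenerates (A : Type*) {R : Type*} [CommRing A] [CommRing R] [Algebra A R]
    (p : Ideal R) (ϖ : R) : Prop :=
  ∀ y : A, algebraMap A R y ∈ p → ∃ v : A, algebraMap A R v ∉ p ∧
    ∃ z : A, algebraMap A R v * algebraMap A R y = algebraMap A R z * ϖ

/-- Common denominators for finitely many elements: if all coefficients of `e` lie in `p`, then a
multiple of `e` by an element outside `p` is divisible by `ϖ`. -/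
theorem LocallyGenerates.exists_aeval_mul {A R : Type*} [CommRing A] [CommRing R] [Algebra A R]
    {p : Ideal R} [p.IsPrime] {ϖ : R} (hA : LocallyGenerates A p ϖ) (b : R) (e : A[X])
    (he : ∀ n, algebraMap A R (e.coeff n) ∈ p) :
    ∃ v : A, algebraMap A R v ∉ p ∧
      ∃ z : A[X], algebraMap A R v * aeval b e = aeval b z * ϖ := by
  choose v hv z hz using fun n => hA _ (he n)
  refine ⟨∏ n ∈ e.support, v n, ?_,
    ∑ n ∈ e.support, C ((∏ m ∈ e.support.erase n, v m) * z n) * X ^ n, ?_⟩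
  · rw [map_prod, Ideal.IsPrime.prod_mem_iff]
    rintro ⟨n, -, hn⟩
    exact hv n hn
  · rw [aeval_eq_sum_range' (Nat.lt_succ_self _), map_sum, Finset.sum_mul, Finset.mul_sum]
    symm
    apply Finset.sum_subset_zero_on_sdiff
    · exact supp_subset_range_natDegree_succ
    · intro n hn
      rw [Finset.mem_sdiff, notMem_support_iff] at hn
      rw [hn.2, zero_smul, mul_zero]
    · intro n hn
      rw [← Finset.mul_prod_erase _ _ hn, Algebra.smul_def]
      simp only [map_mul, aeval_C, map_pow, aeval_X]
      linear_combination -(algebraMap A R (∏ m ∈ e.support.erase n, v m) * b ^ n) * hz n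

/-- Over the residue field of `q`, the minimal polynomial of `β` divides both reductions: `P = mν`
and `h = mη`, with `ν(β) ≠ 0` because the root is simple. Hence `hν - Pη = 0`. Lifting this and
evaluating at `b`, where `P` vanishes, puts a multiple of `h(b)` by an element outside `p` into the
ideal generated by `q`. -/
theorem LocallyGenerates.of_simple_root {A R : Type*} [CommRing A] [CommRing R] [Algebra A R]
    {p : Ideal R} [p.IsPrime] {ϖ : R} (hA : LocallyGenerates A p ϖ) {b : R} {P : A[X]}
    (hP : aeval b P = 0) (hP' : aeval b P.derivative ∉ p) (h : A[X]) (hb : aeval b h ∈ p) :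
    ∃ v : A[X], aeval b v ∉ p ∧ ∃ z : A[X], aeval b v * aeval b h = aeval b z * ϖ := by
  set q := p.comap (algebraMap A R)
  let φ : q.ResidueField →+* p.ResidueField := Ideal.ResidueField.map q p (algebraMap A R) rfl
  let _ : Algebra q.ResidueField p.ResidueField := φ.toAlgebra
  set β := algebraMap R p.ResidueField b
  set ι := algebraMap A q.ResidueField
  have hφ : φ.comp ι = (algebraMap R p.ResidueField).comp (algebraMap A R) := by
    ext a; exact Ideal.ResidueField.map_algebraMap _ _ _ _ _
  have ev (G : A[X]) : aeval β (G.map ι) = algebraMap R p.ResidueField (aeval b G) := by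
    rw [aeval_def, eval₂_map, aeval_def, hom_eval₂]
    exact congrArg (fun f => eval₂ f β G) hφ
  have hz (G : A[X]) : aeval β (G.map ι) = 0 ↔ aeval b G ∈ p := by
    rw [ev, Ideal.algebraMap_residueField_eq_zero]
  obtain ⟨ν, hν⟩ := minpoly.dvd q.ResidueField β ((hz P).2 (hP ▸ p.zero_mem))
  obtain ⟨η, hη⟩ := minpoly.dvd q.ResidueField β ((hz h).2 hb)
  have hνβ : aeval β ν ≠ 0 := by
    intro h0
    apply hP'
    rw [← hz, ← derivative_map, hν, derivative_mul, map_add, map_mul, map_mul, h0, minpoly.aeval]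
    simp
  obtain ⟨c, hc, N, hN⟩ := Ideal.ResidueField.exists_map_eq_C_mul q ν
  obtain ⟨d, hd, E, hE⟩ := Ideal.ResidueField.exists_map_eq_C_mul q η
  change N.map ι = C (ι c) * ν at hN
  change E.map ι = C (ι d) * η at hE
  have hNb : aeval b N ∉ p := by
    rw [← hz, hN, map_mul, aeval_C, mul_eq_zero, not_or, map_eq_zero]
    exact ⟨fun h0 => hc (Ideal.algebraMap_residueField_eq_zero.1 h0), hνβ⟩
  have hd' : algebraMap A R d ∉ p := hd
  obtain ⟨v, hv, z, hvz⟩ := hA.exists_aeval_mul b (C d * h * N - C c * P * E) (by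
    intro n
    change _ ∈ q
    rw [← Ideal.algebraMap_residueField_eq_zero, ← coeff_map]
    have : (C d * h * N - C c * P * E).map ι = 0 := by
      simp only [Polynomial.map_sub, Polynomial.map_mul, map_C, hN, hE, hν, hη]
      ring
    rw [this, coeff_zero])
  refine ⟨C v * C d * N, ?_, z, ?_⟩
  · simp only [map_mul, aeval_C]
    exact fun h0 => ((‹p.IsPrime›.mem_or_mem h0).elim
      (fun h1 => (‹p.IsPrime›.mem_or_mem h1).elim hv hd') hNb)
  · rw [← hvz]
    simp only [map_mul, map_sub, aeval_C, hP]
    ring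

theorem LocallyGenerates.adjoin_simple_root {D R : Type*} [CommRing D] [CommRing R] [Algebra D R]
    {p : Ideal R} [p.IsPrime] {ϖ : R} {A : Subalgebra D R} (hA : LocallyGenerates A p ϖ)
    {b : R} {P : A[X]} (hP : aeval b P = 0) (hP' : aeval b P.derivative ∉ p) :
    LocallyGenerates ((aeval (R := A) b).range.restrictScalars D) p ϖ := by
  rintro ⟨_, g, rfl⟩ hy
  obtain ⟨v, hv, z, h⟩ := hA.of_simple_root hP hP' g hy
  exact ⟨⟨_, v, rfl⟩, hv, ⟨_, z, rfl⟩, h⟩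

/-- If `ϖ` locally generates over the base `D`, it does so over any algebra that is the only
subalgebra closed under adjoining simple roots. -/
theorem LocallyGenerates.of_forall_closed {D R : Type*} [CommRing D] [CommRing R] [Algebra D R]
    {p : Ideal R} [p.IsPrime] {ϖ : R} (hD : LocallyGenerates D p ϖ)
    (H : ∀ A : Subalgebra D R, (∀ (b : R) (P : A[X]), aeval b P = 0 →
      aeval b P.derivative ∉ p → b ∈ A) → A = ⊤) :
    LocallyGenerates R p ϖ := by
  obtain ⟨A, -, hA⟩ := zorn_le_nonempty₀ {A : Subalgebra D R | LocallyGenerates A p ϖ} (by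
    intro c hc hchain A₀ hA₀
    have : Nonempty c := ⟨⟨A₀, hA₀⟩⟩
    have hdir : Directed (· ≤ ·) (fun A : c => (A : Subalgebra D R)) :=
      hchain.directed
    refine ⟨⨆ A : c, (A : Subalgebra D R), ?_,
      fun A hA => le_iSup (fun A : c => (A : Subalgebra D R)) ⟨A, hA⟩⟩
    rintro ⟨y, hy⟩ hyp
    have hy' := hy
    rw [← SetLike.mem_coe, Subalgebra.coe_iSup_of_directed hdir, Set.mem_iUnion] at hy'
    obtain ⟨B, hB⟩ := hy'
    obtain ⟨v, hv, z, h⟩ := hc B.2 ⟨y, hB⟩ hyp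
    have hle : (B : Subalgebra D R) ≤ ⨆ A : c, (A : Subalgebra D R) :=
      le_iSup (fun A : c => (A : Subalgebra D R)) B
    exact ⟨⟨v, hle v.2⟩, hv, ⟨z, hle z.2⟩, h⟩) ⊥ (by
    rintro ⟨_, y, rfl⟩ hy
    obtain ⟨v, hv, z, h⟩ := hD y hy
    exact ⟨⟨_, v, rfl⟩, hv, ⟨_, z, rfl⟩, h⟩)
  -- A maximal subalgebra already contains every such root, since adjoining it keeps the property.
  have htop : A = ⊤ := H A fun b P hP hP' => by
    have hle : A ≤ (aeval (R := A) b).range.restrictScalars D :=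
      fun a ha => ⟨C ⟨a, ha⟩, by simp⟩
    exact hA.2 (hA.1.adjoin_simple_root hP hP') hle ⟨X, by simp⟩
  subst htop
  intro y hy
  obtain ⟨v, hv, z, h⟩ := hA.1 ⟨y, trivial⟩ hy
  exact ⟨v, hv, z, h⟩

/-! ### Discrete valuation rings from local generators -/

/-- An algebraic extension `R` of a principal ideal domain `D` is a discrete valuation ring
locally at `p`, if the maximal ideal is locally generated by every generator of `p ∩ D`. -/
theorem isDiscreteValuationRing_of_locallyGenerates {D R : Type*} [CommRing D] [IsDomain D]
    [IsPrincipalIdealRing D] [CommRing R] [IsDomain R] [Algebra D R] [Algebra.IsAlgebraic D R]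
    (hinj : Function.Injective (algebraMap D R)) {p : Ideal R} [p.IsPrime] (hp : p ≠ ⊥)
    (H : ∀ ϖ : D, LocallyGenerates D p (algebraMap D R ϖ) →
      LocallyGenerates R p (algebraMap D R ϖ)) :
    IsDiscreteValuationRing (Localization.AtPrime p) := by
  obtain ⟨ϖ, hϖ⟩ := (IsPrincipalIdealRing.principal (p.comap (algebraMap D R))).principal
  rw [Ideal.submodule_span_eq] at hϖ
  have hϖp : algebraMap D R ϖ ∈ p := by
    have : ϖ ∈ p.comap (algebraMap D R) := hϖ ▸ Ideal.mem_span_singleton_self ϖ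
    exact this
  have hmem (c : D) : algebraMap D R c ∈ p ↔ ϖ ∣ c := by
    rw [← Ideal.mem_span_singleton, ← hϖ, Ideal.mem_comap]
  have hϖ0 : ϖ ≠ 0 := by
    rintro rfl
    obtain ⟨y, hy, hy0⟩ := Submodule.exists_mem_ne_zero_of_ne_bot hp
    refine Ideal.comap_ne_bot_of_algebraic_mem hy0 hy (Algebra.IsAlgebraic.isAlgebraic (R := D) y) ?_
    rw [hϖ]; simp
  have hgen : LocallyGenerates R p (algebraMap D R ϖ) := H ϖ fun y hy => by
    obtain ⟨z, rfl⟩ := (hmem y).1 hy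
    exact ⟨1, by simpa using (Ideal.ne_top_iff_one p).1 ‹p.IsPrime›.ne_top, z, by
      simp [mul_comm]⟩
  let L := Localization.AtPrime p
  set f := algebraMap R L
  have hf : Function.Injective f := IsLocalization.injective L p.primeCompl_le_nonZeroDivisors
  have hunit (y : R) : IsUnit (f y) ↔ y ∉ p := IsLocalization.AtPrime.isUnit_to_map_iff L p y
  set π := f (algebraMap D R ϖ)
  have hπ0 : π ≠ 0 := by
    rw [Ne, map_eq_zero_iff f hf, map_eq_zero_iff _ hinj]; exact hϖ0
  have hπu : ¬ IsUnit π := fun h => (hunit _).1 h hϖp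
  have hfrac (x : L) : ∃ y : R, Associated x (f y) := by
    obtain ⟨⟨y, s⟩, h⟩ := IsLocalization.surj p.primeCompl x
    exact ⟨y, ((hunit s).2 s.2).unit, h⟩
  have hdvd (x : L) (hx : ¬ IsUnit x) : π ∣ x := by
    obtain ⟨y, hy⟩ := hfrac x
    rw [hy.isUnit_iff, hunit, not_not] at hx
    obtain ⟨v, hv, z, h⟩ := hgen y hx
    rw [hy.dvd_iff_dvd_right]
    refine ((hunit v).2 hv).dvd_mul_left.1 ⟨f z, ?_⟩
    rw [← map_mul, ← map_mul, mul_comm _ z]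
    exact congrArg f h
  -- This stands in for Noetherianity: `x` divides a nonzero element `ϖ ^ m * u` of `D` with `u` a
  -- unit in `L`.
  have hmult (x : L) (hx : x ≠ 0) : FiniteMultiplicity π x := by
    obtain ⟨y, hy⟩ := hfrac x
    have hy0 : y ≠ 0 := by
      rintro rfl
      rw [map_zero, associated_zero_iff_eq_zero] at hy
      exact hx hy
    obtain ⟨c, hc0, hc⟩ := (Algebra.IsAlgebraic.isAlgebraic (R := D) y).exists_nonzero_dvd
      (mem_nonZeroDivisors_of_ne_zero hy0)
    have hϖu : ¬ IsUnit ϖ := fun h => hπu ((h.map (algebraMap D R)).map f)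
    obtain ⟨u, hu, hun⟩ := (FiniteMultiplicity.of_not_isUnit hϖu hc0).exists_eq_pow_mul_and_not_dvd
    rw [← hmem, ← hunit] at hun
    generalize multiplicity ϖ c = m at hu
    refine ⟨m, fun hd => ?_⟩
    have h1 : π ^ (m + 1) ∣ f (algebraMap D R c) :=
      (hd.trans hy.dvd).trans (map_dvd f hc)
    rw [hu, map_mul, map_mul, map_pow, map_pow, hun.dvd_mul_right, pow_succ] at h1
    exact hπu (isUnit_of_dvd_one ((mul_dvd_mul_iff_left (pow_ne_zero _ hπ0)).1
      (by rw [mul_one]; exact h1)))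
  refine IsDiscreteValuationRing.ofHasUnitMulPowIrreducibleFactorization ⟨π, ⟨hπu, ?_⟩, ?_⟩
  · intro a b hab
    by_contra! hcon
    obtain ⟨a', rfl⟩ := hdvd a hcon.1
    obtain ⟨b', rfl⟩ := hdvd b hcon.2
    refine hπu (IsUnit.of_mul_eq_one (a' * b') (mul_left_cancel₀ hπ0 ?_))
    rw [mul_one]
    nth_rewrite 3 [hab]
    ring
  · intro x hx
    obtain ⟨c, hc, hcn⟩ := (hmult x hx).exists_eq_pow_mul_and_not_dvd
    have hcu : IsUnit c := by_contra fun h => hcn (hdvd c h)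
    exact ⟨multiplicity π x, hcu.unit, hc.symm⟩

/-- Differentiate an annihilating polynomial as long as its derivative still vanishes at `r`; in
characteristic 0 the derivative of a nonconstant polynomial is nonzero and of smaller degree. -/
theorem IsAlgebraic.exists_simple_root {D R : Type*} [CommRing D] [CharZero D] [IsDomain D]
    [CommRing R] [Algebra D R]
    (hinj : Function.Injective (algebraMap D R)) {r : R} (hr : IsAlgebraic D r) :
    ∃ P : D[X], aeval r P = 0 ∧ aeval r P.derivative ≠ 0 := by
  obtain ⟨P, hP0, hP⟩ := hr
  induction hn : P.natDegree using Nat.strong_induction_on generalizing P with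
  | _ n ih =>
    by_cases h : aeval r P.derivative = 0
    · have hdeg : P.natDegree ≠ 0 := fun h0 => by
        rw [natDegree_eq_zero] at h0
        obtain ⟨c, rfl⟩ := h0
        rw [aeval_C, map_eq_zero_iff _ hinj] at hP
        exact hP0 (by rw [hP, C_0])
      refine ih _ ?_ P.derivative (fun h0 => hdeg (derivative_eq_zero.1 h0)) h rfl
      exact hn ▸ natDegree_derivative_lt hdeg
    · exact ⟨P, hP, h⟩

/-! ### Propagation along the iterates of the endomorphism -/

/-- If `p ≠ 0` is fixed by `τ`, and `R` is generated over `k` by the iterated images under `τ` of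
a set `s` with an element `t` over which `R` is algebraic, then `R` is a discrete valuation ring
locally at `p`, provided the elements of `s` and `τ(s)` are modulo `p` simple roots of polynomials
over `k[t]`. -/
theorem isDiscreteValuationRing_of_comap_eq {k R : Type*} [Field k] [CommRing R] [IsDomain R]
    [Algebra k R] [Algebra k[X] R] [IsScalarTower k k[X] R] [Algebra.IsAlgebraic k[X] R]
    (hinj : Function.Injective (algebraMap k[X] R)) (σ : k →+* k) (τ : R →+* R)
    (hτ : ∀ c : k, τ (algebraMap k R c) = algebraMap k R (σ c)) (s : Set R)
    (hX : algebraMap k[X] R X ∈ s)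
    (hs : Algebra.adjoin k {x : R | ∃ n : ℕ, ∃ a ∈ s, x = τ^[n] a} = ⊤)
    {p : Ideal R} [p.IsPrime] (hp : p ≠ ⊥) (hτp : p.comap τ = p)
    (P : R → k[X][X]) (hP : ∀ r, aeval r (P r) = 0)
    (h0 : ∀ a ∈ s, aeval a (P a).derivative ∉ p)
    (h1 : ∀ a ∈ s, aeval (τ a) (P (τ a)).derivative ∉ p) :
    IsDiscreteValuationRing (Localization.AtPrime p) := by
  refine isDiscreteValuationRing_of_locallyGenerates hinj hp fun ϖ hϖ => hϖ.of_forall_closed ?_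
  intro A hA
  have hk (c : k) : algebraMap k R c ∈ A := by
    rw [IsScalarTower.algebraMap_apply k k[X] R]; exact A.algebraMap_mem _
  have hτk (n : ℕ) (c : k) : (τ ^ n) (algebraMap k R c) ∈ A := by
    induction n generalizing c with
    | zero => exact hk c
    | succ n ih => rw [pow_succ, RingHom.mul_def, RingHom.comp_apply, hτ]; exact ih _
  have hτp' (n : ℕ) (y : R) : (τ ^ n) y ∈ p ↔ y ∈ p := by
    induction n with
    | zero => rfl
    | succ n ih =>
      rw [← ih, pow_succ', RingHom.mul_def, RingHom.comp_apply, ← Ideal.mem_comap, hτp]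
  have hit (n : ℕ) : ∀ a ∈ s, (τ ^ n) a ∈ A := by
    induction n with
    | zero =>
      intro a ha
      refine hA a ((P a).map (algebraMap k[X] A)) ?_ ?_
      · rw [aeval_map_algebraMap]; exact hP a
      · rw [derivative_map, aeval_map_algebraMap]; exact h0 a ha
    | succ n ih =>
      intro a ha
      have hD (g : k[X]) : ((τ ^ n).comp (algebraMap k[X] R)) g ∈ A := by
        induction g using Polynomial.induction_on' with
        | add g h hg hh => rw [map_add]; exact A.add_mem hg hh
        | monomial m c =>
          rw [← C_mul_X_pow_eq_monomial, map_mul, map_pow]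
          refine A.mul_mem ?_ (A.pow_mem (ih _ hX) _)
          have := hτk n c
          rwa [IsScalarTower.algebraMap_apply k k[X] R] at this
      -- Twisting by `τ^n` turns the relation for `τ a` over `k[t]` into one for `τ^(n+1) a` over
      -- `τ^n(k[t])`, which lies in `A` by induction because `t ∈ s`.
      let ψ : k[X] →+* A := ((τ ^ n).comp (algebraMap k[X] R)).codRestrict A hD
      have hψ (Q : k[X][X]) : aeval ((τ ^ (n + 1)) a) (Q.map ψ) = (τ ^ n) (aeval (τ a) Q) := by
        rw [aeval_def, eval₂_map, aeval_def, hom_eval₂]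
        rfl
      refine hA _ ((P (τ a)).map ψ) ?_ ?_
      · rw [hψ, hP, map_zero]
      · rw [derivative_map, hψ, hτp']; exact h1 a ha
  have hle : Algebra.adjoin k {x : R | ∃ n : ℕ, ∃ a ∈ s, x = τ^[n] a} ≤ A.restrictScalars k := by
    refine Algebra.adjoin_le ?_
    rintro _ ⟨n, a, ha, rfl⟩
    have := hit n a ha
    rwa [RingHom.coe_pow] at this
  rw [hs] at hle
  exact eq_top_iff.2 fun x _ => hle (Algebra.mem_top (x := x))

/-! ### Transcendence degree and the generic open set -/

theorem trdeg_le_one_of_totalDimension_le_one {k R : Type*} [Field k] [CommRing R] [IsDomain R]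
    [Algebra k R] {τ : R →+* R} (h : totalDimension k τ ≤ 1) : Algebra.trdeg k R ≤ 1 := by
  -- The zero ideal is among the primes in the supremum, and `R` embeds in its residue field.
  have h' := (le_iSup (fun p : {p : PrimeSpectrum R // ∀ a ∈ p.asIdeal, τ a ∈ p.asIdeal} =>
    Cardinal.toENat (Algebra.trdeg k p.1.asIdeal.ResidueField)) ⟨⊥, fun a ha => by
      have ha : a = 0 := ha
      rw [ha, map_zero]; exact Ideal.zero_mem _⟩).trans h
  rw [Cardinal.toENat_le_one] at h'
  refine (trdeg_le_of_injective
    (IsScalarTower.toAlgHom k R (⊥ : PrimeSpectrum R).asIdeal.ResidueField) ?_).trans h'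
  refine (injective_iff_map_eq_zero _).2 fun a ha => ?_
  exact Ideal.algebraMap_residueField_eq_zero.1 ha

theorem isAlgebraic_polynomial_of_trdeg_le_one {k R : Type*} [Field k] [CommRing R] [IsDomain R]
    [Algebra k R] [Algebra k[X] R] [IsScalarTower k k[X] R]
    (hinj : Function.Injective (algebraMap k[X] R)) (h : Algebra.trdeg k R ≤ 1) :
    Algebra.IsAlgebraic k[X] R := by
  set t := algebraMap k[X] R X
  have haeval : (aeval t : k[X] →ₐ[k] R) = IsScalarTower.toAlgHom k k[X] R := by
    ext; simp [t]
  have ht : Transcendental k t := by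
    rw [transcendental_iff_injective, haeval]
    exact hinj
  have hb := (algebraicIndependent_singleton_iff (x := fun _ : PUnit => t)
    PUnit.unit).2 ht |>.isTranscendenceBasis_of_trdeg_le_of_finite (by simpa using h)
  have := hb.isAlgebraic
  rw [Set.range_const, Algebra.adjoin_singleton_eq_range_aeval, haeval] at this
  exact Algebra.IsAlgebraic.of_ringHom_of_comp_eq
    (IsScalarTower.toAlgHom k k[X] R).rangeRestrict (RingHom.id R)
    (AlgHom.rangeRestrict_surjective _) Function.injective_id rfl

theorem mainTheorem9 {k R : Type*} [Field k] [CharZero k] [CommRing R] [Algebra k R]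
    (σ : k →+* k) (S : Set (R →+* R)) (hS : S.Nonempty) (hfin : S.Finite)
    (hX : IsAffineDifferenceCurve σ S) :
    ∃ U : Set (differenceSpec S), IsOpen U ∧ U.Nonempty ∧
      ∀ x ∈ U, x.1.asIdeal ≠ ⊥ → IsNonsingularPoint x := by
  have := hX.isDomain
  obtain ⟨τ₀, hτ₀⟩ := hS
  let η : differenceSpec S := ⟨⊥, Set.mem_biUnion hτ₀ (PrimeSpectrum.ext (by
    change Ideal.comap τ₀ ⊥ = ⊥
    exact Ideal.comap_bot_of_injective _ (hX.isDifferenceRing.injective τ₀ hτ₀)))⟩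
  -- In the algebraic case `R` is a field, so the generic point is the only one.
  by_cases halg : Algebra.IsAlgebraic k R
  · refine ⟨Set.univ, isOpen_univ, ⟨η, trivial⟩, fun x _ hx => (hx ?_).elim⟩
    have hF : IsField R := isField_of_isIntegral_of_isField' (Field.toIsField k)
    let _ := hF.toField
    exact (Ideal.eq_bot_or_top x.1.asIdeal).resolve_right x.1.isPrime.ne_top
  have htr := trdeg_le_one_of_totalDimension_le_one (hX.totalDimension_eq_one τ₀ hτ₀).le
  obtain ⟨t, ht⟩ : ∃ t : R, Transcendental k t := by
    by_contra! h
    exact halg ⟨fun r => not_not.1 (h r)⟩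
  let _ : Algebra k[X] R := (aeval t : k[X] →ₐ[k] R).toRingHom.toAlgebra
  have : IsScalarTower k k[X] R := IsScalarTower.of_algebraMap_eq' (aeval t).comp_algebraMap.symm
  have hinj : Function.Injective (algebraMap k[X] R) := transcendental_iff_injective.1 ht
  have ht' : algebraMap k[X] R X = t := aeval_X t
  have := isAlgebraic_polynomial_of_trdeg_le_one hinj htr
  choose P hP hP' using fun r : R =>
    (Algebra.IsAlgebraic.isAlgebraic (R := k[X]) r).exists_simple_root hinj
  choose s hs using fun τ : S => hX.finiteType τ τ.2
  have := hfin.fintype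
  classical
  -- A point of `X` may be fixed by any one `τ ∈ S`, so `f` covers all of them; `S` being finite
  -- makes this a single nonzero element.
  let f : R := ∏ τ : S, ∏ a ∈ insert t (s τ),
    aeval a (P a).derivative * aeval (τ.1 a) (P (τ.1 a)).derivative
  refine ⟨Subtype.val ⁻¹' (PrimeSpectrum.basicOpen f : Set (PrimeSpectrum R)),
    (PrimeSpectrum.basicOpen f).isOpen.preimage continuous_subtype_val, ⟨η, fun h => ?_⟩,
    fun x hx hx0 => ?_⟩
  · have h : f = 0 := h
    simp only [f, Finset.prod_eq_zero_iff, mul_eq_zero] at h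
    obtain ⟨τ, -, a, -, h | h⟩ := h
    exacts [hP' _ h, hP' _ h]
  · obtain ⟨τ, hτ, hxτ⟩ := Set.mem_iUnion₂.1 x.2
    have hfx : f ∉ x.1.asIdeal := hx
    have hdvd : ∀ a ∈ (insert t (s ⟨τ, hτ⟩) : Finset R),
        aeval a (P a).derivative * aeval (τ a) (P (τ a)).derivative ∉ x.1.asIdeal := by
      intro a ha h
      refine hfx (Ideal.mem_of_dvd _ ((Finset.dvd_prod_of_mem _ ha).trans
        (Finset.dvd_prod_of_mem _ (Finset.mem_univ (⟨τ, hτ⟩ : S)))) h)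
    refine ⟨inferInstance, isDiscreteValuationRing_of_comap_eq hinj σ τ (hX.map_algebraMap τ hτ)
      (insert t (s ⟨τ, hτ⟩) : Finset R) (by simp [ht']) ?_ hx0 (congrArg (·.asIdeal) hxτ) P hP
      (fun a ha h => hdvd a ha (Ideal.mul_mem_right _ _ h))
      (fun a ha h => hdvd a ha (Ideal.mul_mem_left _ _ h))⟩
    rw [eq_top_iff, ← hs ⟨τ, hτ⟩]
    refine Algebra.adjoin_mono ?_
    rintro _ ⟨n, a, ha, rfl⟩
    exact ⟨n, a, Finset.mem_coe.2 (Finset.mem_insert_of_mem ha), rfl⟩
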